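/- Let $S$ and $I$ be measurable spaces (for instance measure spaces), and let $\mathcal B=\mathcal B(S\times I,\mathbb R)$ be the Banach space of bounded measurable functions $f:S\times I\to\mathbb R$, written $f_i(x)=f(x,i)$, with the norm $\|f\|_\infty=\sup_{x\in S,\,i\in I}|f_i(x)|$. Let $a_i,b_i:S\to[-\infty,\infty]$ $(i\in I)$ be such that $(x,i)\mapsto a_i(x)$ and $(x,i)\mapsto b_i(x)$ are measurable, $a_i(x)<b_i(x)$ for all $x\in S$, $i\in I$, and $\inf_{i\in I,\,x\in S}\,(b_i(x)-a_i(x))>0$. For a function $f:S\times I\to\mathbb R$ let $[f]_a^b$ be the coordinatewise clip, $([f]_a^b)_i(x)=\min\{\max\{a_i(x),f_i(x)\},b_i(x)\}$, and let $M=\{f\in\mathcal B : [f]_a^b=f\}$ with the metric $d(f,g)=\|f-g\|_\infty$. Let $V:M\to\mathcal B$ be locally Lipschitz. Then $M$ is a complete metric space, and $X_t(f):=[f+tV(f)]_a^b$ $(f\in M,\ 0\le t\le 1)$ defines an arc field on $M$, i.e. a continuous map $X:M\times[0,1]\to M$ with $X_0(f)=f$, which satisfies the following conditions, where $B(f_0,r)$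 is the open ball. E1: for each $f_0\in M$ there are $r>0$, $\delta>0$ and $\Lambda\in\mathbb R$ with $d(X_t(f),X_t(g))\le(1+t\Lambda)\,d(f,g)$ for all $f,g\in B(f_0,r)$ and $t\in[0,1]$ with $t<\delta$. E2: for each $f_0\in M$ there are $r>0$, $\delta>0$ and $\Omega\in\mathbb R$ with $d(X_{s+t}(f),X_t(X_s(f)))\le st\,\Omega$ for all $f\in B(f_0,r)$ and $0\le t\le s<\delta$ with $s+t\le1$. By a local forward flow of $X$ we mean a function $T:M\to(0,\infty]$ such that $W_T=\{(f,t): 0\le t<T(f)\}$ is open in $M\times[0,\infty)$, together with a continuous map $F:W_T\to M$, $(f,t)\mapsto F_t(f)$, such that $F_0(f)=f$, such that $F_t(F_s(f))=F_{s+t}(f)$ whenever $s<T(f)$, $t<T(F_s(f))$ and $s+t<T(f)$, and such that $F$ is forward tangent to $X$: $$\lim_{h\to0^+}\frac{d\big(F_{t+h}(f),X_h(F_t(f))\big)}{h}=0\qquad\text{for all } (f,t)\in W_T .$$ There is a unique maximal local forward flow $(T,F)$ of $X$: for $s<T(f)$ one has $t<T(F_s(f))$ if and only if $s+t<T(f)$,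 and every local forward flow $(T',F')$ of $X$ is a restriction of it, i.e. $T'\le T$ and $F'_t(f)=F_t(f)$ for $0\le t<T'(f)$. If $V$ is globally Lipschitz, then $T\equiv\infty$, so that $F:M\times[0,\infty)\to M$ is a continuous semigroup that is forward tangent to $X$ at all $(f,t)$, and it is the only such semigroup. -/

import Mathlib

open Filter Topology
open scoped NNReal ENNReal unitInterval

/-! ### Arc fields and their flows on a metric space -/

section ArcFields

variable {M : Type*} [MetricSpace M]

/-- An arc field: a continuous map `X : M × [0,1] → M` with `X_0 = id`; `X f t` is `X_t(f)`. -/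
structure IsArcField (X : M → I → M) : Prop where
  continuous : Continuous (Function.uncurry X)
  zero : ∀ f, X f 0 = f

/-- Condition E1. -/
def CondE1 (X : M → I → M) : Prop :=
  ∀ f₀ : M, ∃ r > (0 : ℝ), ∃ δ > (0 : ℝ), ∃ Λ : ℝ,
    ∀ f ∈ Metric.ball f₀ r, ∀ g ∈ Metric.ball f₀ r, ∀ t : I, (t : ℝ) < δ →
      dist (X f t) (X g t) ≤ (1 + t * Λ) * dist f g

/-- Condition E2. The parameter `u` is `s + t`, which has to lie in `[0,1]`. -/
def CondE2 (X : M → I → M) : Prop :=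
  ∀ f₀ : M, ∃ r > (0 : ℝ), ∃ δ > (0 : ℝ), ∃ Ω : ℝ,
    ∀ f ∈ Metric.ball f₀ r, ∀ s t u : I, (u : ℝ) = s + t → t ≤ s → (s : ℝ) < δ →
      dist (X f u) (X (X f s) t) ≤ s * t * Ω

/-- The curve `γ` is forward tangent to `X` at time `t`:
`d(γ(t+h), X_h(γ(t))) / h → 0` as `h → 0⁺`. -/
def TangentAt (X : M → I → M) (γ : ℝ≥0 → M) (t : ℝ≥0) : Prop :=
  Tendsto (fun h : I => dist (γ (t + unitInterval.toNNReal h)) (X (γ t) h) / (h : ℝ))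
    (𝓝[>] 0) (𝓝 0)

/-- A (global) forward flow of `X`: a continuous semigroup `F : M × [0,∞) → M` that is forward
tangent to `X`; `F f t` is `F_t(f)`. -/
structure IsFlowOf (X : M → I → M) (F : M → ℝ≥0 → M) : Prop where
  continuous : Continuous (Function.uncurry F)
  zero : ∀ f, F f 0 = f
  add : ∀ f s t, F (F f s) t = F f (s + t)
  tangent : ∀ f t, TangentAt X (F f) t

/-- The domain `{(f,t) | 0 ≤ t < T(f)}` in `M × [0,∞)` determined by a lifetime function `T`. -/
def lifeDomain (T : M → ℝ≥0∞) : Set (M × ℝ≥0) := {p | (p.2 : ℝ≥0∞) < T p.1}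

/-- A local forward flow of `X` with lifetimes `T : M → (0,∞]`: it is defined on
`{(f,t) | 0 ≤ t < T(f)}` (values of `F` outside this set carry no meaning), which is open in
`M × [0,∞)`, is continuous there, has the semigroup property as far as it is defined, and is
forward tangent to `X`. -/
structure IsLocalFlowOf (X : M → I → M) (T : M → ℝ≥0∞) (F : M → ℝ≥0 → M) : Prop where
  pos : ∀ f, 0 < T f
  isOpen : IsOpen (lifeDomain T)
  continuousOn : ContinuousOn (Function.uncurry F) (lifeDomain T)
  zero : ∀ f, F f 0 = f
  add : ∀ (f : M) (s t : ℝ≥0), (s : ℝ≥0∞) < T f → (t : ℝ≥0∞) < T (F f s) →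
    ((s + t : ℝ≥0) : ℝ≥0∞) < T f → F (F f s) t = F f (s + t)
  tangent : ∀ (f : M) (t : ℝ≥0), (t : ℝ≥0∞) < T f → TangentAt X (F f) t

end ArcFields

/-! ### Clipping -/

section Clip

/-- The clip `[x]_a^b = min (max a x) b` of a real number at extended real bounds; it is a real
number whenever `a < b`. -/
noncomputable def clip (a b : EReal) (x : ℝ) : ℝ := (min (max a (x : EReal)) b).toReal

theorem coe_clip {a b : EReal} (h : a < b) (x : ℝ) :
    ((clip a b x : ℝ) : EReal) = min (max a (x : EReal)) b := by
  refine EReal.coe_toReal (ne_of_lt ?_) (ne_of_gt ?_)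
  · exact (min_lt_iff.2 (Or.inl (max_lt (lt_of_lt_of_le h le_top) (EReal.coe_lt_top x))))
  · exact lt_min (lt_max_of_lt_right (EReal.bot_lt_coe x)) (lt_of_le_of_lt bot_le h)

theorem clip_clip {a b : EReal} (h : a < b) (x : ℝ) : clip a b (clip a b x) = clip a b x := by
  have : ((clip a b (clip a b x) : ℝ) : EReal) = (clip a b x : ℝ) := by
    rw [coe_clip h, coe_clip h]
    rw [max_eq_right (le_min (le_max_left _ _) h.le), min_eq_left (min_le_right _ _)]
  exact_mod_cast this

theorem abs_clip_sub_clip_le {a b : EReal} (h : a < b) (x y : ℝ) :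
    |clip a b x - clip a b y| ≤ |x - y| := by
  wlog hxy : x ≤ y generalizing x y
  · rw [abs_sub_comm, abs_sub_comm x]
    exact this y x (le_of_not_ge hxy)
  have key : ((clip a b y : ℝ) : EReal) ≤ ((clip a b x + (y - x) : ℝ) : EReal) := by
    have hd : (0 : EReal) ≤ ((y - x : ℝ) : EReal) := by exact_mod_cast sub_nonneg.2 hxy
    rw [EReal.coe_add, coe_clip h, coe_clip h]
    rcases le_total b (max a (x : EReal)) with h1 | h1
    · rw [min_eq_right h1]
      exact (min_le_right _ _).trans (le_add_of_nonneg_right hd)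
    · rw [min_eq_left h1]
      refine (min_le_left _ _).trans (max_le ?_ ?_)
      · exact (le_max_left _ _).trans (le_add_of_nonneg_right hd)
      · calc (y : EReal) = (x : EReal) + ((y - x : ℝ) : EReal) := by
              rw [← EReal.coe_add]; congr 1; ring
          _ ≤ _ := by gcongr; exact le_max_right _ _
  have mono : ((clip a b x : ℝ) : EReal) ≤ ((clip a b y : ℝ) : EReal) := by
    rw [coe_clip h, coe_clip h]
    exact min_le_min_right _ (max_le_max_left _ (by exact_mod_cast hxy))
  have key' : clip a b y ≤ clip a b x + (y - x) := by exact_mod_cast key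
  have mono' : clip a b x ≤ clip a b y := by exact_mod_cast mono
  rw [abs_sub_comm, abs_sub_comm x, abs_of_nonneg (by linarith), abs_of_nonneg (by linarith)]
  linarith

end Clip

/-! ### Bounded measurable functions -/

section BoundedMeasurable

/-- The space `𝓑(Ω, ℝ)` of bounded measurable functions `Ω → ℝ` (genuine functions, not classes)
with the supremum norm, as a subspace of the space `ℓ^∞(Ω)` of all bounded functions. -/
def BddMeas (Ω : Type*) [MeasurableSpace Ω] : Submodule ℝ (lp (fun _ : Ω => ℝ) ∞) where
  carrier := {f | Measurable fun p => f p}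
  add_mem' := fun {_ _} hf hg => Measurable.add hf hg
  zero_mem' := measurable_const
  smul_mem' := fun c _ hf => Measurable.const_smul hf c

variable {S J : Type*} [MeasurableSpace S] [MeasurableSpace J]

/-- The coordinatewise clip `([g]_a^b)(x, i) = [g(x, i)]_{a_i(x)}^{b_i(x)}`. -/
noncomputable def clipFun (a b : J → S → EReal) (g : S × J → ℝ) : S × J → ℝ :=
  fun p => clip (a p.2 p.1) (b p.2 p.1) (g p)

/-- The set `M = {f ∈ 𝓑(S × J, ℝ) | [f]_a^b = f}`, a metric space with the metric `‖f - g‖_∞`. -/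
def clipSpace (a b : J → S → EReal) : Set (BddMeas (S × J)) :=
  {f | clipFun a b (fun p => f.1 p) = fun p => f.1 p}

/-- The arc field `X_t(f) = [f + t V(f)]_a^b` on `M`. -/
noncomputable def clipArc {a b : J → S → EReal}
    (ha : Measurable fun p : S × J => a p.2 p.1) (hb : Measurable fun p : S × J => b p.2 p.1)
    (hab : ∀ i x, a i x < b i x) (V : clipSpace a b → BddMeas (S × J))
    (f : clipSpace a b) (t : I) : clipSpace a b :=
  ⟨⟨⟨clipFun a b fun p => f.1.1 p + (t : ℝ) * (V f).1 p, by
        refine memℓp_infty ⟨‖f.1.1‖ + |(t : ℝ)| * ‖(V f).1‖, ?_⟩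
        rintro _ ⟨p, rfl⟩
        have h1 := abs_clip_sub_clip_le (hab p.2 p.1) (f.1.1 p + (t : ℝ) * (V f).1 p) (f.1.1 p)
        have h2 : clip (a p.2 p.1) (b p.2 p.1) (f.1.1 p) = f.1.1 p := congrFun f.2 p
        have h3 : |f.1.1 p| ≤ ‖f.1.1‖ := lp.norm_apply_le_norm ENNReal.top_ne_zero f.1.1 p
        have h4 : |(V f).1 p| ≤ ‖(V f).1‖ := lp.norm_apply_le_norm ENNReal.top_ne_zero (V f).1 p
        rw [h2, add_sub_cancel_left, abs_mul] at h1
        have h5 := mul_le_mul_of_nonneg_left h4 (abs_nonneg (t : ℝ))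
        have h6 := abs_sub_abs_le_abs_sub
          (clip (a p.2 p.1) (b p.2 p.1) (f.1.1 p + (t : ℝ) * (V f).1 p)) (f.1.1 p)
        change |clip (a p.2 p.1) (b p.2 p.1) (f.1.1 p + (t : ℝ) * (V f).1 p)| ≤ _
        linarith⟩, by
      have hf : Measurable fun p => f.1.1 p := f.1.2
      have hV : Measurable fun p => (V f).1 p := (V f).2
      exact ((ha.max (hf.add (hV.const_mul (t : ℝ))).coe_real_ereal).min hb).ereal_toReal⟩, by
    funext p
    exact clip_clip (hab p.2 p.1) _⟩

end BoundedMeasurable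

/-! ### Approximate solutions of an arc field in real time -/

section ApproxLines

open Set

variable {M : Type*} [MetricSpace M]

/-! Clipping is 1-Lipschitz, so `clipAdd` changes by at most the change of the point plus the change
of the increment (`dist_clipAdd_le`); this gives E1. For a fixed `v` the maps `f ↦ [f + tv]_a^b`
form an exact semigroup on `M`: each coordinate is pushed in one direction and, once it meets a
bound, stays there (`clipAdd_add_smul`). The defect in E2 therefore comes only from replacing `V(f)`
by `V(X_s f)`, and is at most `t · K · sC` if `V` is `K`-Lipschitz and bounded by `C` near `f`
(`arcBoundsOn_clipArcReal`).

The rest is Cauchy–Lipschitz theory for arc fields on a complete metric space. Grönwall's inequality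
bounds the distance of two approximate solutions by their initial distance and tangency defects
(`IsApproxLine.dist_le`). Euler polygons of step `η` have defect `ηΩ`, so they converge uniformly,
and the limit is an exact solution (`ArcBoundsOn.exists_isApproxLine_zero`). With zero defects the
same inequality gives uniqueness and Lipschitz dependence on the initial value.

Taking the supremum of existence times gives the maximal flow; compactness of a time interval makes
its domain open and the flow continuous (`HasLine.stableUpTo`). Orbits of any other local flow are
exact solutions, so uniqueness makes it a restriction. For globally Lipschitz `V` the existence time
is the same for all starting points, so solutions can be continued forever. -/

/-- A continuous curve `γ` on `[0, τ]` whose forward tangency defect with respect to `X` is at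
most `ε` at all times in `[0, τ)`. For `ε = 0` this is an exact solution. -/
structure IsApproxLine (X : M → ℝ → M) (ε : ℝ) (γ : ℝ → M) (τ : ℝ) : Prop where
  continuousOn : ContinuousOn γ (Icc 0 τ)
  tangent : ∀ t ∈ Ico 0 τ, ∀ η > ε, ∀ᶠ z in 𝓝[>] t, dist (γ z) (X (γ t) (z - t)) ≤ η * (z - t)

/-- Lipschitz, speed and semigroup-defect bounds for `X` on a set `U`. -/
structure ArcBoundsOn (X : M → ℝ → M) (U : Set M) (K C Ω : ℝ) : Prop where
  K_nonneg : 0 ≤ K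
  C_nonneg : 0 ≤ C
  Ω_nonneg : 0 ≤ Ω
  zero : ∀ f, X f 0 = f
  lip : ∀ f ∈ U, ∀ g ∈ U, ∀ t, 0 ≤ t → dist (X f t) (X g t) ≤ (1 + t * K) * dist f g
  speed : ∀ f ∈ U, ∀ s t, dist (X f s) (X f t) ≤ C * |s - t|
  semigroup : ∀ f ∈ U, ∀ s t, 0 ≤ s → 0 ≤ t → X f s ∈ U →
    dist (X f (s + t)) (X (X f s) t) ≤ s * t * Ω

/-- Rests on `e^y - 1 ≤ y e^y`, and removes both the quotient `ε / K` and the case `K = 0` from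
later estimates. -/
theorem gronwallBound_le_mul_exp {δ K ε x : ℝ} (hK : 0 ≤ K) (hε : 0 ≤ ε) :
    gronwallBound δ K ε x ≤ (δ + ε * x) * Real.exp (K * x) := by
  rcases hK.eq_or_lt with rfl | hK'
  · simp [gronwallBound_K0]
  · rw [gronwallBound_of_K_ne_0 hK'.ne']
    have h1 : Real.exp (K * x) - 1 ≤ K * x * Real.exp (K * x) := by
      have h := Real.add_one_le_exp (-(K * x))
      have h2 : Real.exp (-(K * x)) * Real.exp (K * x) = 1 := by rw [← Real.exp_add]; simp
      nlinarith [Real.exp_pos (K * x)]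
    have h2 : ε / K * (Real.exp (K * x) - 1) ≤ ε / K * (K * x * Real.exp (K * x)) := by gcongr
    have h3 : ε / K * (K * x * Real.exp (K * x)) = ε * x * Real.exp (K * x) := by
      field_simp
    linarith

namespace IsApproxLine

variable {X : M → ℝ → M} {ε τ : ℝ} {γ β : ℝ → M}

theorem mono (h : IsApproxLine X ε γ τ) {τ' : ℝ} (hτ : τ' ≤ τ) : IsApproxLine X ε γ τ' :=
  ⟨h.1.mono (Icc_subset_Icc_right hτ), fun t ht => h.2 t (Ico_subset_Ico_right hτ ht)⟩

theorem congr (h : IsApproxLine X ε γ τ) (he : EqOn β γ (Icc 0 τ)) : IsApproxLine X ε β τ := by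
  refine ⟨h.1.congr he, fun t ht η hη => ?_⟩
  filter_upwards [h.2 t ht η hη, Ioo_mem_nhdsGT ht.2] with z hz hz'
  rwa [he (Ico_subset_Icc_self ht), he ⟨ht.1.trans hz'.1.le, hz'.2.le⟩]

theorem shift (h : IsApproxLine X ε γ τ) {s : ℝ} (hs : 0 ≤ s) :
    IsApproxLine X ε (fun t => γ (s + t)) (τ - s) := by
  refine ⟨h.1.comp (by fun_prop) fun t ht => ⟨by linarith [ht.1], by linarith [ht.2]⟩,
    fun t ht η hη => ?_⟩
  have ht' : s + t ∈ Ico 0 τ := ⟨by linarith [ht.1], by linarith [ht.2]⟩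
  have htend : Tendsto (fun z => s + z) (𝓝[>] t) (𝓝[>] (s + t)) := by
    refine tendsto_nhdsWithin_iff.2 ⟨?_, ?_⟩
    · exact ((continuous_const.add continuous_id).tendsto t).mono_left nhdsWithin_le_nhds
    · filter_upwards [self_mem_nhdsWithin] with z hz
      exact (add_lt_add_iff_left s).2 hz
  filter_upwards [htend.eventually (h.2 _ ht' η hη)] with z hz
  rwa [add_sub_add_left_eq_sub] at hz

/-- Concatenation of approximate solutions. -/
theorem concat (h : IsApproxLine X ε γ τ) {ρ : ℝ} (h' : IsApproxLine X ε β ρ) (hτ : 0 ≤ τ)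
    (hρ : 0 ≤ ρ) (he : β 0 = γ τ) :
    IsApproxLine X ε (fun t => if t ≤ τ then γ t else β (t - τ)) (τ + ρ) := by
  have e1 : EqOn (fun t => if t ≤ τ then γ t else β (t - τ)) γ (Icc 0 τ) :=
    fun t ht => if_pos ht.2
  have e2 : EqOn (fun t => if t ≤ τ then γ t else β (t - τ)) (fun t => β (t - τ)) (Ici τ) := by
    intro t ht
    rcases (mem_Ici.1 ht).eq_or_lt with rfl | h3
    · simp [he]
    · exact if_neg (not_le.2 h3)
  generalize (fun t => if t ≤ τ then γ t else β (t - τ)) = c at e1 e2 ⊢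
  refine ⟨?_, fun t ht η hη => ?_⟩
  · rw [← Icc_union_Icc_eq_Icc hτ (by linarith : τ ≤ τ + ρ)]
    refine ContinuousOn.union_of_isClosed (h.1.congr e1) ?_ isClosed_Icc isClosed_Icc
    refine ContinuousOn.congr (f := fun t => β (t - τ)) ?_ (e2.mono Icc_subset_Ici_self)
    exact h'.1.comp (by fun_prop) fun t ht => ⟨by linarith [ht.1], by linarith [ht.2]⟩
  · rcases lt_or_ge t τ with h3 | h3
    · filter_upwards [h.2 t ⟨ht.1, h3⟩ η hη, Ioo_mem_nhdsGT h3] with z hz hz'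
      rwa [e1 ⟨ht.1, h3.le⟩, e1 ⟨ht.1.trans hz'.1.le, hz'.2.le⟩]
    · have h4 : t - τ ∈ Ico 0 ρ := ⟨by linarith, by linarith [ht.2]⟩
      have htend : Tendsto (fun z => z - τ) (𝓝[>] t) (𝓝[>] (t - τ)) := by
        refine tendsto_nhdsWithin_iff.2 ⟨?_, ?_⟩
        · exact ((continuous_id.sub continuous_const).tendsto t).mono_left nhdsWithin_le_nhds
        · filter_upwards [self_mem_nhdsWithin] with z hz
          exact sub_lt_sub_right hz τ
      filter_upwards [htend.eventually (h'.2 _ h4 η hη), self_mem_nhdsWithin] with z hz hz'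
      rw [e2 h3, e2 (h3.trans (le_of_lt hz'))]
      rwa [sub_sub_sub_cancel_right] at hz

/-- Grönwall's inequality for two approximate solutions. -/
theorem dist_le {U : Set M} {K C Ω ε' : ℝ} (hX : ArcBoundsOn X U K C Ω)
    (h : IsApproxLine X ε γ τ) (h' : IsApproxLine X ε' β τ) (hε : 0 ≤ ε + ε')
    (hγ : ∀ t ∈ Ico 0 τ, γ t ∈ U) (hβ : ∀ t ∈ Ico 0 τ, β t ∈ U) :
    ∀ t ∈ Icc 0 τ, dist (γ t) (β t) ≤
      (dist (γ 0) (β 0) + (ε + ε') * t) * Real.exp (K * t) := by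
  intro t ht
  have key := le_gronwallBound_of_liminf_deriv_right_le (f := fun t => dist (γ t) (β t))
    (f' := fun t => K * dist (γ t) (β t) + (ε + ε')) (δ := dist (γ 0) (β 0)) (K := K)
    (ε := ε + ε') (a := 0) (b := τ) (continuous_dist.comp_continuousOn (h.1.prodMk h'.1)) ?_ le_rfl (fun _ _ => le_rfl) t ht
  · rw [sub_zero] at key
    exact key.trans (gronwallBound_le_mul_exp hX.K_nonneg hε)
  · intro x hx r hr
    -- Two of the three `η` absorb the slack in the two tangency conditions; the third makes the
    -- inequality strict.
    obtain ⟨η, hη, hηr⟩ : ∃ η > 0, K * dist (γ x) (β x) + (ε + ε') + 3 * η = r :=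
      ⟨(r - (K * dist (γ x) (β x) + (ε + ε'))) / 3, by linarith, by ring⟩
    refine Eventually.frequently ?_
    filter_upwards [h.2 x hx (ε + η) (by linarith), h'.2 x hx (ε' + η) (by linarith),
      self_mem_nhdsWithin] with z h1 h2 hz
    have hz : 0 < z - x := sub_pos.2 hz
    have h3 := hX.lip _ (hγ x hx) _ (hβ x hx) (z - x) hz.le
    have h4 := dist_triangle4 (γ z) (X (γ x) (z - x)) (X (β x) (z - x)) (β z)
    rw [dist_comm (X (β x) (z - x)) (β z)] at h4
    rw [inv_mul_lt_iff₀ hz]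
    nlinarith

end IsApproxLine

/-! ### Euler polygons and local existence -/

namespace ArcBoundsOn

variable {X : M → ℝ → M} {U : Set M} {K C Ω : ℝ}

theorem dist_arc_le (hX : ArcBoundsOn X U K C Ω) {f : M} (hf : f ∈ U) {t : ℝ} (ht : 0 ≤ t) :
    dist (X f t) f ≤ C * t := by
  have := hX.speed f hf t 0
  rwa [hX.zero, sub_zero, abs_of_nonneg ht] at this

/-- The arcs of `X` are approximate solutions. -/
theorem isApproxLine_arc (hX : ArcBoundsOn X U K C Ω) {f : M} {τ : ℝ} (hf : f ∈ U)
    (h : ∀ t ∈ Ico 0 τ, X f t ∈ U) : IsApproxLine X (τ * Ω) (X f) τ := by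
  refine ⟨?_, fun t ht η hη => ?_⟩
  · refine (LipschitzWith.of_dist_le_mul (K := ⟨C, hX.C_nonneg⟩) fun s t => ?_).continuous.continuousOn
    exact hX.speed f hf s t
  · filter_upwards [self_mem_nhdsWithin] with z hz
    have hz : 0 < z - t := sub_pos.2 hz
    -- The semigroup defect gives tangency error `tΩ` at time `t`, and `t < τ`.
    have h1 := hX.semigroup f hf t (z - t) ht.1 hz.le (h t ht)
    rw [add_sub_cancel] at h1
    have h2 := mul_le_mul_of_nonneg_right ht.2.le hX.Ω_nonneg
    nlinarith

/-- Euler polygons. -/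
theorem exists_isApproxLine_nat_mul (hX : ArcBoundsOn X U K C Ω) {f : M} {ρ η : ℝ}
    (hU : Metric.ball f ρ ⊆ U) (hη : 0 ≤ η) (k : ℕ) (hk : C * (k * η) < ρ) :
    ∃ γ : ℝ → M, γ 0 = f ∧ IsApproxLine X (η * Ω) γ (k * η) ∧
      ∀ t ∈ Icc 0 (k * η), dist (γ t) f ≤ C * t := by
  induction k with
  | zero =>
    refine ⟨fun _ => f, rfl, ⟨continuousOn_const, fun t ht => ?_⟩, fun t ht => ?_⟩
    · simp at ht
    · simpa using mul_nonneg hX.C_nonneg ht.1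
  | succ k ih =>
    have hC := hX.C_nonneg
    have hkη : 0 ≤ k * η := by positivity
    push_cast at hk ⊢
    have hk' : C * (k * η) + C * η < ρ := by linarith
    have hCη : 0 ≤ C * η := by positivity
    obtain ⟨γ, h0, h1, h2⟩ := ih (by linarith)
    have hd := h2 (k * η) ⟨hkη, le_rfl⟩
    have hmem : γ (k * η) ∈ U := hU (Metric.mem_ball.2 (by linarith))
    have hdist : ∀ t ∈ Icc 0 η, dist (X (γ (k * η)) t) f ≤ C * (k * η + t) := fun t ht => by
      have h3 := hX.dist_arc_le hmem ht.1
      have h4 := dist_triangle (X (γ (k * η)) t) (γ (k * η)) f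
      linarith
    have harc : IsApproxLine X (η * Ω) (X (γ (k * η))) η := by
      refine hX.isApproxLine_arc hmem fun t ht => hU (Metric.mem_ball.2 ?_)
      have h3 := hdist t (Ico_subset_Icc_self ht)
      have h4 := mul_le_mul_of_nonneg_left ht.2.le hC
      linarith
    have hcat := h1.concat harc hkη hη (hX.zero _)
    rw [add_mul, one_mul]
    refine ⟨_, ?_, hcat, fun t ht => ?_⟩
    · simp [hkη, h0]
    · rcases le_or_gt t (k * η) with h3 | h3
      · simpa only [if_pos h3] using h2 t ⟨ht.1, h3⟩
      · simp only [if_neg (not_le.2 h3)]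
        have := hdist (t - k * η) ⟨by linarith, by linarith [ht.2]⟩
        rwa [add_sub_cancel] at this

/-- Local existence of exact solutions, with a lower bound for the time of existence. -/
theorem exists_isApproxLine_zero [CompleteSpace M] (hX : ArcBoundsOn X U K C Ω) {f : M} {ρ τ : ℝ}
    (hU : Metric.ball f ρ ⊆ U) (hτ : 0 ≤ τ) (hτρ : C * τ < ρ) :
    ∃ γ : ℝ → M, γ 0 = f ∧ IsApproxLine X 0 γ τ ∧ ∀ t ∈ Icc 0 τ, dist (γ t) f ≤ C * t := by
  have hC := hX.C_nonneg
  have hΩ := hX.Ω_nonneg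
  have hin : ∀ {p : M} {t : ℝ}, t ∈ Icc 0 τ → dist p f ≤ C * t → p ∈ U := fun {p t} ht hp => by
    have := mul_le_mul_of_nonneg_left ht.2 hC
    exact hU (Metric.mem_ball.2 (by linarith))
  -- The `n`-th polygon makes `n + 1` steps of this size, so all polygons live exactly on `[0, τ]`.
  set e : ℕ → ℝ := fun n => τ / (n + 1) with he
  have hen : ∀ n, 0 ≤ e n := fun n => by positivity
  have hlim : Tendsto e atTop (𝓝 0) := by
    simpa using (tendsto_one_div_add_atTop_nhds_zero_nat (𝕜 := ℝ)).const_mul τ |>.congr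
      fun n => by simp [he, div_eq_mul_inv]
  have hγ : ∀ n : ℕ, ∃ γ : ℝ → M, γ 0 = f ∧ IsApproxLine X (e n * Ω) γ τ ∧
      ∀ t ∈ Icc 0 τ, dist (γ t) f ≤ C * t := fun n => by
    have h1 : ((n + 1 : ℕ) : ℝ) * e n = τ := by
      simp only [he]; push_cast; field_simp
    have := hX.exists_isApproxLine_nat_mul hU (hen n) (n + 1) (by rwa [h1])
    rwa [h1] at this
  choose γ h0 h1 h2 using hγ
  have hmem : ∀ n, ∀ t ∈ Icc 0 τ, γ n t ∈ U := fun n t ht => hin ht (h2 n t ht)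
  set A := Ω * τ * Real.exp (K * τ) with hA
  have hA0 : 0 ≤ A := by positivity
  have hdist : ∀ n m, ∀ t ∈ Icc 0 τ, dist (γ n t) (γ m t) ≤ (e n + e m) * A := fun n m t ht => by
    have := (h1 n).dist_le hX (h1 m) (by have := hen n; have := hen m; positivity)
      (fun t ht => hmem n t (Ico_subset_Icc_self ht))
      (fun t ht => hmem m t (Ico_subset_Icc_self ht)) t ht
    rw [h0, h0, dist_self, zero_add] at this
    refine this.trans ?_
    have hexp : Real.exp (K * t) ≤ Real.exp (K * τ) :=
      Real.exp_le_exp.2 (mul_le_mul_of_nonneg_left ht.2 hX.K_nonneg)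
    have hn := hen n
    have hm := hen m
    calc (e n * Ω + e m * Ω) * t * Real.exp (K * t)
        ≤ (e n * Ω + e m * Ω) * τ * Real.exp (K * τ) := by
          have := ht.1; have := ht.2; gcongr
      _ = (e n + e m) * A := by rw [hA]; ring
  have hconv : ∀ t ∈ Icc 0 τ, ∃ p, Tendsto (fun n => γ n t) atTop (𝓝 p) := fun t ht => by
    refine cauchySeq_tendsto_of_complete (cauchySeq_of_le_tendsto_0' (fun n => (e n + e n) * A) ?_ ?_)
    · intro n m hnm
      refine (hdist n m t ht).trans ?_
      have : e m ≤ e n := by simp only [he]; gcongr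
      gcongr
    · simpa using (hlim.add hlim).mul_const A
  have : Nonempty M := ⟨f⟩
  choose! g hg using hconv
  have hg0 : ∀ t ∈ Icc 0 τ, dist (g t) f ≤ C * t := fun t ht =>
    le_of_tendsto ((hg t ht).dist tendsto_const_nhds) (Eventually.of_forall fun n => h2 n t ht)
  have hgU : ∀ t ∈ Icc 0 τ, g t ∈ U := fun t ht => hin ht (hg0 t ht)
  have hunif : TendstoUniformlyOn γ g atTop (Icc 0 τ) := by
    refine Metric.tendstoUniformlyOn_iff.2 fun η hη => ?_
    have hl : Tendsto (fun n => e n * A) atTop (𝓝 0) := by simpa using hlim.mul_const A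
    filter_upwards [hl.eventually (gt_mem_nhds hη)] with n hn t ht
    refine lt_of_le_of_lt ?_ hn
    rw [dist_comm]
    refine le_of_tendsto_of_tendsto (tendsto_const_nhds.dist (hg t ht))
      (by simpa using (hlim.const_add (e n)).mul_const A)
      (Eventually.of_forall fun m => hdist n m t ht)
  refine ⟨g, ?_, ⟨hunif.continuousOn (Frequently.of_forall fun n => (h1 n).1), ?_⟩, hg0⟩
  · have h00 : (0 : ℝ) ∈ Icc 0 τ := ⟨le_rfl, hτ⟩
    simpa using hg0 0 h00
  · intro t ht η hη
    have htc := Ico_subset_Icc_self ht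
    -- The arc issuing from `g t` is itself an approximate solution on `[0, h]` with defect `hΩ`.
    -- Comparing it with the polygons restarted at time `t` and letting `n → ∞` leaves an error of
    -- order `h²`, hence tangency.
    have hloc : ∀ h, 0 ≤ h → h ≤ τ - t → dist (g (t + h)) (X (g t) h) ≤
        h * Ω * h * Real.exp (K * h) := fun h hh0 hh => by
      have hth : t + h ∈ Icc 0 τ := ⟨by linarith [ht.1], by linarith⟩
      have harcU : ∀ s ∈ Ico 0 h, X (g t) s ∈ U := fun s hs => by
        refine hin (t := t + s) ⟨by linarith [ht.1, hs.1], by linarith [hs.2]⟩ ?_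
        have h3 := hX.dist_arc_le (hgU t htc) hs.1
        have h4 := dist_triangle (X (g t) s) (g t) f
        have h5 := hg0 t htc
        linarith
      have harc := hX.isApproxLine_arc (τ := h) (hgU t htc) harcU
      have hn : ∀ n, dist (γ n (t + h)) (X (g t) h) ≤
          (dist (γ n t) (g t) + (e n * Ω + h * Ω) * h) * Real.exp (K * h) := fun n => by
        have := (((h1 n).shift ht.1).mono hh).dist_le hX harc
          (by have := hen n; positivity)
          (fun s hs => hmem n _ ⟨by linarith [ht.1, hs.1], by linarith [hs.2]⟩) harcU h ⟨hh0, le_rfl⟩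
        simpa only [add_zero, hX.zero] using this
      refine le_of_tendsto_of_tendsto' ((hg _ hth).dist tendsto_const_nhds) ?_ hn
      have hl : Tendsto (fun n => (dist (γ n t) (g t) + (e n * Ω + h * Ω) * h) * Real.exp (K * h))
          atTop (𝓝 ((dist (g t) (g t) + (0 * Ω + h * Ω) * h) * Real.exp (K * h))) :=
        (((hg t htc).dist tendsto_const_nhds).add
          (((hlim.mul_const Ω).add_const _).mul_const h)).mul_const _
      simpa using hl
    have hsmall : ∀ᶠ z in 𝓝[>] t, (z - t) * Ω * Real.exp (K * (z - t)) < η := by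
      have hc : Continuous fun z => (z - t) * Ω * Real.exp (K * (z - t)) := by fun_prop
      have := hc.tendsto t
      simp only [sub_self, zero_mul] at this
      exact (this.mono_left nhdsWithin_le_nhds).eventually (gt_mem_nhds hη)
    filter_upwards [hsmall, Ioo_mem_nhdsGT ht.2] with z hz hz'
    have h3 := hloc (z - t) (by linarith [hz'.1]) (by linarith [hz'.2])
    rw [add_sub_cancel] at h3
    have h4 : 0 < z - t := by linarith [hz'.1]
    nlinarith

end ArcBoundsOn

end ApproxLines

/-! ### The maximal flow -/

section MaximalFlow

open Set

variable {M : Type*} [MetricSpace M]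

/-- Every point has a ball on which the bounds of `ArcBoundsOn` hold. -/
def LocalArcBounds (X : M → ℝ → M) : Prop :=
  ∀ p, ∃ r > (0 : ℝ), ∃ K C Ω : ℝ, ArcBoundsOn X (Metric.ball p r) K C Ω

/-- There is an exact solution on `[0, τ]` starting at `f`. -/
def HasLine (X : M → ℝ → M) (f : M) (τ : ℝ) : Prop :=
  ∃ γ : ℝ → M, γ 0 = f ∧ IsApproxLine X 0 γ τ

/-- The lifetime of the maximal solution starting at `f`. -/
noncomputable def life (X : M → ℝ → M) (f : M) : ℝ≥0∞ :=
  ⨆ (τ : ℝ≥0) (_ : HasLine X f τ), (τ : ℝ≥0∞)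

open Classical in
/-- The maximal solution starting at `f`, with the value `f` after its lifetime. -/
noncomputable def lineFlow (X : M → ℝ → M) (f : M) (t : ℝ) : M :=
  if h : HasLine X f t then h.choose t else f

variable {X : M → ℝ → M}

theorem IsApproxLine.exists_mem_ball {ε τ r : ℝ} {γ : ℝ → M} (h : IsApproxLine X ε γ τ)
    (hτ : 0 ≤ τ) (hr : 0 < r) :
    ∃ δ > 0, ∀ t ∈ Icc 0 τ, t < δ → γ t ∈ Metric.ball (γ 0) r := by
  obtain ⟨δ, hδ, hδ'⟩ := Metric.continuousWithinAt_iff.1 (h.1 0 ⟨le_rfl, hτ⟩) r hr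
  refine ⟨δ, hδ, fun t ht htδ => hδ' ht ?_⟩
  rwa [Real.dist_eq, sub_zero, abs_of_nonneg ht.1]

/-- Exact solutions are determined by their initial value. -/
theorem IsApproxLine.eqOn (hX : LocalArcBounds X) {γ β : ℝ → M} {τ : ℝ}
    (h : IsApproxLine X 0 γ τ) (h' : IsApproxLine X 0 β τ) (h0 : γ 0 = β 0) :
    EqOn γ β (Icc 0 τ) := by
  -- Continuous induction: the set of agreement is closed, and Grönwall in a small ball around a
  -- common value extends it to the right.
  refine IsClosed.Icc_subset_of_forall_exists_gt (s := {t | γ t = β t}) ?_ h0 ?_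
  · have := (h.1.prodMk h'.1).preimage_isClosed_of_isClosed isClosed_Icc (isClosed_diagonal (X := M))
    rwa [inter_comm] at this
  · rintro x ⟨hx, hxτ⟩ y hy
    have hx : γ x = β x := hx
    obtain ⟨r, hr, K, C, Ω, hb⟩ := hX (γ x)
    have g1 := h.shift hxτ.1
    have g2 := h'.shift hxτ.1
    have hτx : 0 < τ - x := sub_pos.2 hxτ.2
    obtain ⟨δ₁, hδ₁, d1⟩ := g1.exists_mem_ball hτx.le hr
    obtain ⟨δ₂, hδ₂, d2⟩ := g2.exists_mem_ball hτx.le hr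
    simp only [add_zero, ← hx] at d1 d2
    set d := min (min δ₁ δ₂) (min (τ - x) (y - x)) with hd
    have hd0 : 0 < d := lt_min (lt_min hδ₁ hδ₂) (lt_min hτx (sub_pos.2 hy))
    have hdτ : d ≤ τ - x := (min_le_right _ _).trans (min_le_left _ _)
    have hdy : d ≤ y - x := (min_le_right _ _).trans (min_le_right _ _)
    have hd1 : d ≤ δ₁ := (min_le_left _ _).trans (min_le_left _ _)
    have hd2 : d ≤ δ₂ := (min_le_left _ _).trans (min_le_right _ _)
    have key := (g1.mono hdτ).dist_le hb (g2.mono hdτ) (by simp)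
      (fun t ht => d1 t ⟨ht.1, ht.2.le.trans hdτ⟩ (ht.2.trans_le hd1))
      (fun t ht => d2 t ⟨ht.1, ht.2.le.trans hdτ⟩ (ht.2.trans_le hd2)) d ⟨hd0.le, le_rfl⟩
    simp only [add_zero, hx, dist_self, zero_mul] at key
    exact ⟨x + d, dist_le_zero.1 key, by linarith, by linarith⟩

theorem HasLine.mono {f : M} {τ τ' : ℝ} (h : HasLine X f τ) (hτ : τ' ≤ τ) : HasLine X f τ' := by
  obtain ⟨γ, h0, h1⟩ := h
  exact ⟨γ, h0, h1.mono hτ⟩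

theorem hasLine_zero (f : M) : HasLine X f 0 :=
  ⟨fun _ => f, rfl, continuousOn_const, fun t ht => by simp at ht⟩

theorem lt_life_iff {f : M} {t : ℝ≥0} :
    (t : ℝ≥0∞) < life X f ↔ ∃ τ : ℝ≥0, t < τ ∧ HasLine X f τ := by
  simp only [life, lt_iSup_iff, ENNReal.coe_lt_coe, exists_prop]
  exact exists_congr fun _ => and_comm

/-- `lineFlow` chooses a separate solution for each time; uniqueness makes these choices agree. -/
theorem IsApproxLine.lineFlow_eq (hX : LocalArcBounds X) {γ : ℝ → M} {τ : ℝ}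
    (h : IsApproxLine X 0 γ τ) {t : ℝ} (ht : t ∈ Icc 0 τ) : lineFlow X (γ 0) t = γ t := by
  have hl : HasLine X (γ 0) t := ⟨γ, rfl, h.mono ht.2⟩
  rw [lineFlow, dif_pos hl]
  exact IsApproxLine.eqOn hX hl.choose_spec.2 (h.mono ht.2) hl.choose_spec.1 ⟨ht.1, le_rfl⟩

theorem lineFlow_zero (f : M) : lineFlow X f 0 = f := by
  rw [lineFlow, dif_pos (hasLine_zero f)]
  exact (hasLine_zero (X := X) f).choose_spec.1

theorem HasLine.isApproxLine (hX : LocalArcBounds X) {f : M} {τ : ℝ} (h : HasLine X f τ) :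
    IsApproxLine X 0 (lineFlow X f) τ := by
  obtain ⟨γ, rfl, h1⟩ := h
  exact h1.congr fun t ht => h1.lineFlow_eq hX ht

theorem HasLine.add (hX : LocalArcBounds X) {f : M} {s t : ℝ} (hs : 0 ≤ s) (ht : 0 ≤ t)
    (h : HasLine X f s) (h' : HasLine X (lineFlow X f s) t) : HasLine X f (s + t) := by
  refine ⟨_, ?_, (h.isApproxLine hX).concat (h'.isApproxLine hX) hs ht (lineFlow_zero _)⟩
  simp [hs, lineFlow_zero]

theorem HasLine.lineFlow_left (hX : LocalArcBounds X) {f : M} {s t : ℝ} (hs : 0 ≤ s)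
    (h : HasLine X f (s + t)) : HasLine X (lineFlow X f s) t := by
  have := (h.isApproxLine hX).shift hs
  rw [add_sub_cancel_left] at this
  exact ⟨_, by simp, this⟩

theorem HasLine.lineFlow_lineFlow (hX : LocalArcBounds X) {f : M} {s t : ℝ} (hs : 0 ≤ s)
    (ht : 0 ≤ t) (h : HasLine X f (s + t)) :
    lineFlow X (lineFlow X f s) t = lineFlow X f (s + t) := by
  have := (h.isApproxLine hX).shift hs
  rw [add_sub_cancel_left] at this
  simpa using this.lineFlow_eq hX ⟨ht, le_rfl⟩

/-! ### Dependence on the initial value -/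

/-- Near a given point, solutions exist for a uniform time and depend on the initial value in a
Lipschitz way. -/
theorem LocalArcBounds.exists_lipschitz [CompleteSpace M] (hX : LocalArcBounds X) (p : M) :
    ∃ r > 0, ∃ τ > 0, ∃ L ≥ 0, ∀ f ∈ Metric.ball p r, HasLine X f τ ∧
      ∀ g ∈ Metric.ball p r, ∀ t ∈ Icc 0 τ,
        dist (lineFlow X f t) (lineFlow X g t) ≤ L * dist f g := by
  obtain ⟨R, hR, K, C, Ω, hb⟩ := hX p
  have hC := hb.C_nonneg
  set τ := R / 4 / (C + 1) with hτ
  -- In time `τ` a solution moves less than `R / 2`, so one starting in the half ball stays in the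
  -- ball where the bounds hold; `C + 1` avoids dividing by zero.
  have hτ0 : 0 < τ := by positivity
  have hCτ : C * τ < R / 2 := by
    have : (C + 1) * τ = R / 4 := by rw [hτ]; field_simp
    linarith
  have hsub : ∀ f ∈ Metric.ball p (R / 2), Metric.ball f (R / 2) ⊆ Metric.ball p R :=
    fun f hf => Metric.ball_subset_ball' (by have := Metric.mem_ball.1 hf; linarith)
  have hex : ∀ f ∈ Metric.ball p (R / 2), HasLine X f τ ∧
      ∀ t ∈ Icc 0 τ, lineFlow X f t ∈ Metric.ball p R := fun f hf => by
    obtain ⟨γ, rfl, h1, h2⟩ := hb.exists_isApproxLine_zero (hsub f hf) hτ0.le hCτ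
    refine ⟨⟨γ, rfl, h1⟩, fun t ht => ?_⟩
    rw [h1.lineFlow_eq hX ht]
    refine hsub _ hf (Metric.mem_ball.2 ((h2 t ht).trans_lt (lt_of_le_of_lt ?_ hCτ)))
    exact mul_le_mul_of_nonneg_left ht.2 hC
  refine ⟨R / 2, by positivity, τ, hτ0, Real.exp (K * τ), (Real.exp_pos _).le,
    fun f hf => ⟨(hex f hf).1, fun g hg t ht => ?_⟩⟩
  have := ((hex f hf).1.isApproxLine hX).dist_le hb ((hex g hg).1.isApproxLine hX) (by simp)
    (fun t ht => (hex f hf).2 t (Ico_subset_Icc_self ht))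
    (fun t ht => (hex g hg).2 t (Ico_subset_Icc_self ht)) t ht
  rw [add_zero, zero_mul, add_zero, lineFlow_zero, lineFlow_zero, mul_comm] at this
  refine this.trans (mul_le_mul_of_nonneg_right (Real.exp_le_exp.2 ?_) dist_nonneg)
  exact mul_le_mul_of_nonneg_left ht.2 hb.K_nonneg

/-- Solutions exist up to time `t` for all initial values near `f`, and their distance to the
solution starting at `f` is controlled by the distance of the initial values. -/
def StableUpTo (X : M → ℝ → M) (f : M) (t : ℝ) : Prop :=
  ∃ L ≥ (0 : ℝ), ∃ δ > (0 : ℝ), ∀ g ∈ Metric.ball f δ, HasLine X g t ∧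
    ∀ s ∈ Icc 0 t, dist (lineFlow X f s) (lineFlow X g s) ≤ L * dist f g

theorem StableUpTo.mono {f : M} {t t' : ℝ} (h : StableUpTo X f t) (ht : t' ≤ t) :
    StableUpTo X f t' := by
  obtain ⟨L, hL, δ, hδ, h⟩ := h
  exact ⟨L, hL, δ, hδ, fun g hg => ⟨(h g hg).1.mono ht, fun s hs =>
    (h g hg).2 s (Icc_subset_Icc_right ht hs)⟩⟩

theorem stableUpTo_zero (f : M) : StableUpTo X f 0 := by
  refine ⟨1, zero_le_one, 1, one_pos, fun g _ => ⟨hasLine_zero g, fun s hs => ?_⟩⟩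
  obtain rfl : s = 0 := le_antisymm hs.2 hs.1
  simp [lineFlow_zero]

/-- The orbit over `[0, t₀]` is compact, so one step length `τ` extends stability from any time in
it. Finitely many steps reach `t₀`, and one more goes beyond. -/
theorem HasLine.stableUpTo [CompleteSpace M] (hX : LocalArcBounds X) {f : M} {t₀ : ℝ}
    (ht₀ : 0 ≤ t₀) (h : HasLine X f t₀) : ∃ τ > t₀, StableUpTo X f τ := by
  have hcont := (h.isApproxLine hX).1
  obtain ⟨τ, hτ, hstep⟩ : ∃ τ > 0, ∀ t ∈ Icc 0 t₀, StableUpTo X f t → StableUpTo X f (t + τ) := by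
    refine isCompact_Icc.induction_on (s := Icc 0 t₀)
      (p := fun A => ∃ τ > (0 : ℝ), ∀ t ∈ A, StableUpTo X f t → StableUpTo X f (t + τ))
      ⟨1, one_pos, fun t ht => ht.elim⟩ ?_ ?_ ?_
    · rintro A B hAB ⟨τ, hτ, H⟩
      exact ⟨τ, hτ, fun t ht => H t (hAB ht)⟩
    · rintro A B ⟨τ, hτ, H⟩ ⟨τ', hτ', H'⟩
      refine ⟨min τ τ', lt_min hτ hτ', fun t ht hs => ?_⟩
      rcases ht with ht | ht
      · exact (H t ht hs).mono (by gcongr; exact min_le_left _ _)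
      · exact (H' t ht hs).mono (by gcongr; exact min_le_right _ _)
    · intro x hx
      obtain ⟨r, hr, τ, hτ, L', hL', hloc⟩ := hX.exists_lipschitz (lineFlow X f x)
      have hev : ∀ᶠ t in 𝓝[Icc 0 t₀] x, lineFlow X f t ∈ Metric.ball (lineFlow X f x) r :=
        (hcont x hx) (Metric.ball_mem_nhds _ hr)
      refine ⟨_, inter_mem self_mem_nhdsWithin hev, τ, hτ, ?_⟩
      rintro t ⟨ht, htr⟩ ⟨L, hL, δ, hδ, hst⟩
      have htr : dist (lineFlow X f t) (lineFlow X f x) < r := htr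
      -- Chosen so that an error of at most `L * d` at time `t` fits into the room left in the ball
      -- of radius `r`.
      set d := (r - dist (lineFlow X f t) (lineFlow X f x)) / (L + 1) with hd
      have hd0 : 0 < d := by have := sub_pos.2 htr; positivity
      have hLd : (L + 1) * d = r - dist (lineFlow X f t) (lineFlow X f x) := by
        rw [hd]; field_simp
      have hball : ∀ g ∈ Metric.ball f (min δ d), HasLine X g (t + τ) ∧
          lineFlow X g t ∈ Metric.ball (lineFlow X f x) r := fun g hg => by
        have hgδ := Metric.ball_subset_ball (min_le_left δ d) hg
        have hgd : dist f g < d := by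
          rw [dist_comm]; exact Metric.ball_subset_ball (min_le_right δ d) hg
        have h1 := (hst g hgδ).2 t ⟨ht.1, le_rfl⟩
        have h2 := dist_triangle_left (lineFlow X g t) (lineFlow X f x) (lineFlow X f t)
        have h3 : L * dist f g ≤ L * d := by gcongr
        have h4 : lineFlow X g t ∈ Metric.ball (lineFlow X f x) r :=
          Metric.mem_ball.2 (by linarith)
        exact ⟨(hst g hgδ).1.add hX ht.1 hτ.le (hloc _ h4).1, h4⟩
      have hf := hball f (Metric.mem_ball_self (lt_min hδ hd0))
      -- This constant dominates both `L`, needed up to time `t`, and `L * L'`, needed after it.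
      refine ⟨L * (L' + 1), by positivity, min δ d, lt_min hδ hd0, fun g hg => ?_⟩
      have hg' := hball g hg
      have hgδ := Metric.ball_subset_ball (min_le_left δ d) hg
      refine ⟨hg'.1, fun s hs => ?_⟩
      have hLL : 0 ≤ L * L' * dist f g := by positivity
      rcases le_or_gt s t with hst' | hst'
      · have := (hst g hgδ).2 s ⟨hs.1, hst'⟩
        have hLd' : 0 ≤ L * dist f g := by positivity
        nlinarith
      · obtain ⟨u, rfl⟩ : ∃ u, s = t + u := ⟨s - t, by ring⟩
        have hu : u ∈ Icc 0 τ := ⟨by linarith, by linarith [hs.2]⟩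
        rw [← (hf.1.mono hs.2).lineFlow_lineFlow hX ht.1 hu.1,
          ← (hg'.1.mono hs.2).lineFlow_lineFlow hX ht.1 hu.1]
        have h1 := (hloc _ hf.2).2 _ hg'.2 u hu
        have h2 := mul_le_mul_of_nonneg_left ((hst g hgδ).2 t ⟨ht.1, le_rfl⟩) hL'
        have hLd' : 0 ≤ L * dist f g := by positivity
        nlinarith
  have hk : ∀ k : ℕ, ∀ t ∈ Icc 0 t₀, t ≤ k * τ → StableUpTo X f t := fun k => by
    induction k with
    | zero =>
      intro t _ htk
      exact (stableUpTo_zero f).mono (by simpa using htk)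
    | succ k ih =>
      intro t ht htk
      push_cast at htk
      have h1 : max (t - τ) 0 ∈ Icc 0 t₀ := ⟨le_max_right _ _, max_le (by linarith [ht.2]) ht₀⟩
      have h2 : max (t - τ) 0 ≤ k * τ := max_le (by linarith) (by positivity)
      exact (hstep _ h1 (ih _ h1 h2)).mono (by linarith [le_max_left (t - τ) 0])
  obtain ⟨k, hk'⟩ := exists_nat_gt (t₀ / τ)
  rw [div_lt_iff₀ hτ] at hk'
  exact ⟨t₀ + τ, by linarith, hstep _ ⟨ht₀, le_rfl⟩ (hk k t₀ ⟨ht₀, le_rfl⟩ hk'.le)⟩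

/-! ### From real time to the arc field -/

/-- The right-hand side is the tangency condition of `IsApproxLine` with `ε = 0`; only small `h`
matter, so the restriction to `[0,1]` is harmless. -/
theorem tangentAt_iff {Y : M → I → M} (hY : ∀ f (t : I), Y f t = X f t) {γ : ℝ≥0 → M} {t : ℝ≥0} :
    TangentAt Y γ t ↔ ∀ η > 0, ∀ᶠ z in 𝓝[>] (t : ℝ),
      dist (γ z.toNNReal) (X (γ t) (z - t)) ≤ η * (z - t) := by
  have hadd : ∀ h : I, (γ (t + unitInterval.toNNReal h)) = γ ((t : ℝ) + h).toNNReal := fun h => by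
    congr 1
    ext
    rw [Real.coe_toNNReal _ (add_nonneg t.coe_nonneg h.2.1)]
    rfl
  constructor
  · intro H η hη
    have H' := H.eventually (gt_mem_nhds hη)
    obtain ⟨ε, hε, hε'⟩ := Metric.mem_nhdsWithin_iff.1 H'
    filter_upwards [Ioo_mem_nhdsGT (show (t : ℝ) < t + min ε 1 by
      have := lt_min hε one_pos; linarith)] with z hz
    have hz0 : 0 < z - t := by linarith [hz.1]
    have hz1 : z - t < min ε 1 := by linarith [hz.2]
    have hmem : z - t ∈ unitInterval := ⟨hz0.le, (hz1.trans_le (min_le_right _ _)).le⟩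
    have := @hε' ⟨z - t, hmem⟩ ⟨Metric.mem_ball.2 ?_, hz0⟩
    · simp only [mem_ofPred_eq, hadd, hY] at this
      rw [div_lt_iff₀ hz0, add_sub_cancel] at this
      exact this.le
    · rw [Subtype.dist_eq, Real.dist_eq]
      change |z - t - 0| < ε
      rw [sub_zero, abs_of_pos hz0]
      exact hz1.trans_le (min_le_left _ _)
  · intro H
    have htend : Tendsto (fun h : I => (t : ℝ) + h) (𝓝[>] 0) (𝓝[>] (t : ℝ)) := by
      refine tendsto_nhdsWithin_iff.2 ⟨?_, ?_⟩
      · have : Continuous fun h : I => (t : ℝ) + h := by fun_prop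
        simpa using (this.tendsto 0).mono_left nhdsWithin_le_nhds
      · filter_upwards [self_mem_nhdsWithin] with h hh
        have : (0 : ℝ) < h := hh
        simpa using this
    refine Metric.tendsto_nhds.2 fun ε hε => ?_
    filter_upwards [htend.eventually (H (ε / 2) (by positivity)), self_mem_nhdsWithin] with h h1 hh
    have hh : (0 : ℝ) < h := hh
    rw [add_sub_cancel_left, ← hadd, ← hY] at h1
    rw [Real.dist_eq, sub_zero, abs_of_nonneg (by positivity), div_lt_iff₀ hh]
    nlinarith

/-- Curves in `ℝ≥0`-time that are continuous and tangent to the arc field give solutions. -/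
theorem isApproxLine_of_tangentAt {Y : M → I → M} (hY : ∀ f (t : I), Y f t = X f t) {γ : ℝ≥0 → M}
    {τ : ℝ≥0} (hc : ContinuousOn γ (Iic τ)) (ht : ∀ t < τ, TangentAt Y γ t) :
    IsApproxLine X 0 (fun t => γ t.toNNReal) τ := by
  refine ⟨hc.comp continuous_real_toNNReal.continuousOn fun t ht => ?_, fun t htτ η hη => ?_⟩
  · exact Real.toNNReal_le_iff_le_coe.2 ht.2
  · have := (tangentAt_iff hY).1 (ht t.toNNReal ((Real.toNNReal_lt_iff_lt_coe htτ.1).2 htτ.2)) η hη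
    rwa [Real.coe_toNNReal _ htτ.1] at this

theorem continuousOn_Iic_of_lifeDomain {T : M → ℝ≥0∞} {F : M → ℝ≥0 → M}
    (hF : ContinuousOn (Function.uncurry F) (lifeDomain T)) {f : M} {t : ℝ≥0}
    (ht : (t : ℝ≥0∞) < T f) : ContinuousOn (F f) (Iic t) :=
  hF.comp (f := fun s => (f, s)) (by fun_prop) fun _ hs =>
    lt_of_le_of_lt (ENNReal.coe_le_coe.2 hs) ht

theorem IsLocalFlowOf.isApproxLine {Y : M → I → M} (hY : ∀ f (t : I), Y f t = X f t)
    {T : M → ℝ≥0∞} {F : M → ℝ≥0 → M} (hF : IsLocalFlowOf Y T F) {f : M} {t : ℝ≥0}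
    (ht : (t : ℝ≥0∞) < T f) : IsApproxLine X 0 (fun s => F f s.toNNReal) t :=
  isApproxLine_of_tangentAt hY (continuousOn_Iic_of_lifeDomain hF.continuousOn ht)
    fun s hs => hF.tangent f s (lt_trans (ENNReal.coe_lt_coe.2 hs) ht)

theorem isLocalFlowOf_lineFlow [CompleteSpace M] (hX : LocalArcBounds X) {Y : M → I → M}
    (hY : ∀ f (t : I), Y f t = X f t) :
    IsLocalFlowOf Y (life X) (fun f t => lineFlow X f t) := by
  have hstab : ∀ p ∈ lifeDomain (life X), ∃ τ > (p.2 : ℝ), StableUpTo X p.1 τ := fun p hp => by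
    obtain ⟨τ, hτ, hl⟩ := lt_life_iff.1 hp
    exact (hl.mono (NNReal.coe_le_coe.2 hτ.le)).stableUpTo hX p.2.2
  refine ⟨fun f => ?_, isOpen_iff_mem_nhds.2 fun p hp => ?_, fun p hp => ?_, lineFlow_zero,
    fun f s t hs ht hst => ?_, fun f t ht => ?_⟩
  · obtain ⟨r, hr, τ, hτ, L, -, h⟩ := hX.exists_lipschitz f
    have := (lt_life_iff (X := X) (f := f) (t := 0)).2
      ⟨⟨τ, hτ.le⟩, hτ, (h f (Metric.mem_ball_self hr)).1⟩
    simpa using this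
  · obtain ⟨τ, hτ, L, hL, δ, hδ, h⟩ := hstab p hp
    have hτ' : p.2 < τ.toNNReal := Real.lt_toNNReal_iff_coe_lt.2 hτ
    filter_upwards [prod_mem_nhds (Metric.ball_mem_nhds p.1 hδ) (Iio_mem_nhds hτ')] with q hq
    refine lt_life_iff.2 ⟨τ.toNNReal, hq.2, ?_⟩
    rw [Real.coe_toNNReal _ (p.2.2.trans hτ.le)]
    exact (h q.1 hq.1).1
  · obtain ⟨τ, hτ, L, hL, δ, hδ, h⟩ := hstab p hp
    have hτ' : p.2 < τ.toNNReal := Real.lt_toNNReal_iff_coe_lt.2 hτ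
    refine ContinuousAt.continuousWithinAt ?_
    have hcf : Tendsto (fun q : M × ℝ≥0 => lineFlow X p.1 q.2) (𝓝 p) (𝓝 (lineFlow X p.1 p.2)) := by
      have h1 := ((h p.1 (Metric.mem_ball_self hδ)).1.isApproxLine hX).1 p.2 ⟨p.2.2, hτ.le⟩
      refine h1.tendsto.comp (tendsto_nhdsWithin_iff.2 ⟨?_, ?_⟩)
      · have : Continuous fun q : M × ℝ≥0 => (q.2 : ℝ) := by fun_prop
        exact this.tendsto p
      · filter_upwards [prod_mem_nhds univ_mem (Iio_mem_nhds hτ')] with q hq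
        exact ⟨q.2.2, (Real.lt_toNNReal_iff_coe_lt.1 hq.2).le⟩
    -- The initial point is moved first, with a Lipschitz bound uniform in time, and then time is
    -- moved along the fixed solution through `p.1`.
    have hd : Tendsto (fun q : M × ℝ≥0 => L * dist p.1 q.1 +
        dist (lineFlow X p.1 q.2) (lineFlow X p.1 p.2)) (𝓝 p) (𝓝 0) := by
      have h1 : Tendsto (fun q : M × ℝ≥0 => L * dist p.1 q.1) (𝓝 p) (𝓝 (L * dist p.1 p.1)) :=
        (Continuous.tendsto (by fun_prop) p)
      simpa using h1.add (hcf.dist (tendsto_const_nhds (x := lineFlow X p.1 p.2)))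
    refine tendsto_iff_dist_tendsto_zero.2 (squeeze_zero' (Eventually.of_forall fun _ => dist_nonneg)
      ?_ hd)
    filter_upwards [prod_mem_nhds (Metric.ball_mem_nhds p.1 hδ) (Iio_mem_nhds hτ')] with q hq
    have h1 := (h q.1 hq.1).2 q.2 ⟨q.2.2, (Real.lt_toNNReal_iff_coe_lt.1 hq.2).le⟩
    rw [dist_comm] at h1
    exact (dist_triangle _ (lineFlow X p.1 q.2) _).trans (add_le_add h1 le_rfl)
  · obtain ⟨τ, hτ, hl⟩ := lt_life_iff.1 hst
    have := (hl.mono (NNReal.coe_le_coe.2 hτ.le))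
    rw [NNReal.coe_add] at this ⊢
    exact this.lineFlow_lineFlow hX s.2 t.2
  · obtain ⟨τ, hτ, hl⟩ := lt_life_iff.1 ht
    refine (tangentAt_iff hY).2 fun η hη => ?_
    filter_upwards [(hl.isApproxLine hX).2 t ⟨t.2, hτ⟩ η hη, self_mem_nhdsWithin] with z hz hz'
    rwa [Real.coe_toNNReal _ (t.2.trans (le_of_lt hz'))]

theorem lt_life_lineFlow_iff (hX : LocalArcBounds X) {f : M} {s t : ℝ≥0}
    (hs : (s : ℝ≥0∞) < life X f) :
    (t : ℝ≥0∞) < life X (lineFlow X f s) ↔ ((s + t : ℝ≥0) : ℝ≥0∞) < life X f := by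
  obtain ⟨ρ, hs', hl'⟩ := lt_life_iff.1 hs
  rw [lt_life_iff, lt_life_iff]
  constructor
  · rintro ⟨τ, hτ, hl⟩
    refine ⟨s + τ, by gcongr, ?_⟩
    rw [NNReal.coe_add]
    exact (hl'.mono (NNReal.coe_le_coe.2 hs'.le)).add hX s.2 τ.2 hl
  · rintro ⟨τ, hτ, hl⟩
    obtain ⟨u, rfl⟩ : ∃ u, τ = s + u := exists_add_of_le ((le_add_of_nonneg_right (zero_le)).trans hτ.le)
    rw [NNReal.coe_add] at hl
    exact ⟨u, lt_of_add_lt_add_left hτ, hl.lineFlow_left hX s.2⟩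

/-- Orbits of a local flow are exact solutions, so they compete in the supremum defining `life` and
agree with `lineFlow` by uniqueness. -/
theorem IsLocalFlowOf.le_life (hX : LocalArcBounds X) {Y : M → I → M}
    (hY : ∀ f (t : I), Y f t = X f t) {T : M → ℝ≥0∞} {F : M → ℝ≥0 → M}
    (hF : IsLocalFlowOf Y T F) (f : M) :
    T f ≤ life X f ∧ ∀ t : ℝ≥0, (t : ℝ≥0∞) < T f → F f t = lineFlow X f t := by
  have h0 : F f (0 : ℝ).toNNReal = f := by simpa using hF.zero f
  refine ⟨ENNReal.le_of_forall_nnreal_lt fun t ht => ?_, fun t ht => ?_⟩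
  · exact le_iSup₂_of_le t ⟨_, h0, hF.isApproxLine hY ht⟩ le_rfl
  · have := (hF.isApproxLine hY ht).lineFlow_eq hX ⟨t.coe_nonneg, le_rfl⟩
    simp only [h0, Real.toNNReal_coe] at this
    exact this.symm

theorem life_eq_top (hX : LocalArcBounds X) {τ : ℝ} (hτ : 0 < τ) (h : ∀ f, HasLine X f τ) (f : M) :
    life X f = ∞ := by
  have hk : ∀ k : ℕ, ∀ f, HasLine X f (k * τ) := fun k => by
    induction k with
    | zero => simpa using hasLine_zero
    | succ k ih =>
      intro f
      rw [Nat.cast_add_one, add_mul, one_mul]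
      exact (ih f).add hX (by positivity) hτ.le (h _)
  refine ENNReal.eq_top_of_forall_nnreal_le fun t => ?_
  obtain ⟨k, hk'⟩ := exists_nat_gt (t / τ)
  rw [div_lt_iff₀ hτ] at hk'
  exact le_iSup₂_of_le t ((hk k f).mono hk'.le) le_rfl

theorem isFlowOf_iff_isLocalFlowOf {Y : M → I → M} {F : M → ℝ≥0 → M} :
    IsFlowOf Y F ↔ IsLocalFlowOf Y (fun _ => ∞) F := by
  have hu : lifeDomain (fun _ : M => ∞) = univ := by ext; simp [lifeDomain]
  refine ⟨fun h => ⟨fun _ => by simp, by rw [hu]; exact isOpen_univ, h.continuous.continuousOn,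
    h.zero, fun f s t _ _ _ => h.add f s t, fun f t _ => h.tangent f t⟩,
    fun h => ⟨?_, h.zero, fun f s t => h.add f s t (by simp) (by simp) (by simp),
      fun f t => h.tangent f t (by simp)⟩⟩
  have := h.continuousOn
  rwa [hu, continuousOn_univ] at this

end MaximalFlow

/-! ### The clipping arc field -/

section ClipArc

variable {S J : Type*} [MeasurableSpace S] [MeasurableSpace J] {a b : J → S → EReal}

theorem clip_of_mem {a b : EReal} {x : ℝ} (ha : a ≤ x) (hb : (x : EReal) ≤ b) : clip a b x = x := by
  rw [clip, max_eq_right ha, min_eq_left hb, EReal.toReal_coe]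

/-- Under upward pushes only the upper bound can become active, and a point that has reached it
stays there. -/
theorem clip_add_clip_of_nonneg {a b : EReal} (h : a < b) {x v w : ℝ} (hx : clip a b x = x)
    (hv : 0 ≤ v) (hw : 0 ≤ w) : clip a b (clip a b (x + v) + w) = clip a b (x + v + w) := by
  have ha : a ≤ (x : EReal) := by
    have := coe_clip h x
    rw [hx] at this
    rw [this]
    exact le_min (le_max_left _ _) h.le
  have hxv : (x : EReal) ≤ ((x + v : ℝ) : EReal) := by exact_mod_cast le_add_of_nonneg_right hv
  have hvw : ((x + v : ℝ) : EReal) ≤ ((x + v + w : ℝ) : EReal) := by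
    exact_mod_cast le_add_of_nonneg_right hw
  rcases le_total ((x + v : ℝ) : EReal) b with hb | hb
  · rw [clip_of_mem (ha.trans hxv) hb]
  · have h1 : ((clip a b (x + v) : ℝ) : EReal) = b := by
      rw [coe_clip h, max_eq_right (ha.trans hxv), min_eq_right hb]
    have h2 : b ≤ ((clip a b (x + v) + w : ℝ) : EReal) := by
      exact h1.ge.trans (by exact_mod_cast le_add_of_nonneg_right hw)
    have h3 : ∀ y : ℝ, b ≤ y → ((clip a b y : ℝ) : EReal) = b := fun y hy => by
      rw [coe_clip h, min_eq_right (hy.trans (le_max_right _ _))]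
    exact_mod_cast (h3 _ h2).trans (h3 _ (hb.trans hvw)).symm

theorem clip_add_clip_of_nonpos {a b : EReal} (h : a < b) {x v w : ℝ} (hx : clip a b x = x)
    (hv : v ≤ 0) (hw : w ≤ 0) : clip a b (clip a b (x + v) + w) = clip a b (x + v + w) := by
  have hb : (x : EReal) ≤ b := by
    have := coe_clip h x
    rw [hx] at this
    rw [this]
    exact min_le_right _ _
  have hxv : ((x + v : ℝ) : EReal) ≤ (x : EReal) := by exact_mod_cast add_le_of_nonpos_right hv
  have hvw : ((x + v + w : ℝ) : EReal) ≤ ((x + v : ℝ) : EReal) := by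
    exact_mod_cast add_le_of_nonpos_right hw
  have h3 : ∀ y : ℝ, (y : EReal) ≤ a → ((clip a b y : ℝ) : EReal) = a := fun y hy => by
    rw [coe_clip h, max_eq_left hy, min_eq_left h.le]
  rcases le_total a ((x + v : ℝ) : EReal) with ha | ha
  · rw [clip_of_mem ha (hxv.trans hb)]
  · have h2 : ((clip a b (x + v) + w : ℝ) : EReal) ≤ a := by
      exact le_trans (by exact_mod_cast add_le_of_nonpos_right hw) (h3 _ ha).le
    exact_mod_cast (h3 _ h2).trans (h3 _ (hvw.trans ha)).symm

theorem dist_le_of_forall_apply {g h : BddMeas (S × J)} {c : ℝ} (hc : 0 ≤ c)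
    (H : ∀ p, |g.1 p - h.1 p| ≤ c) : dist g h ≤ c := by
  rw [dist_eq_norm]
  exact lp.norm_le_of_forall_le hc H

theorem abs_apply_le_norm (g : BddMeas (S × J)) (p : S × J) : |g.1 p| ≤ ‖g‖ :=
  lp.norm_apply_le_norm ENNReal.top_ne_zero g.1 p

theorem clip_apply_self (f : clipSpace a b) (p : S × J) :
    clip (a p.2 p.1) (b p.2 p.1) (f.1.1 p) = f.1.1 p := congrFun f.2 p

/-! ### Completeness -/

theorem continuous_apply_bddMeas (p : S × J) : Continuous fun g : BddMeas (S × J) => g.1 p := by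
  refine (LipschitzWith.of_dist_le_mul (K := 1) fun g h => ?_).continuous
  rw [NNReal.coe_one, one_mul, dist_eq_norm g h]
  exact abs_apply_le_norm (g - h) p

/-- Norm convergence implies pointwise convergence, and pointwise limits of measurable functions are
measurable; so the subspace is closed in `ℓ^∞`. -/
instance completeSpace_bddMeas : CompleteSpace (BddMeas (S × J)) := by
  suffices h : IsClosed (BddMeas (S × J) : Set (lp (fun _ : S × J => ℝ) ∞)) from
    h.completeSpace_coe
  refine IsSeqClosed.isClosed fun u g hu hg => ?_
  refine measurable_of_tendsto_metrizable (f := fun n p => u n p) hu (tendsto_pi_nhds.2 fun p => ?_)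
  refine tendsto_iff_dist_tendsto_zero.2 (squeeze_zero (fun _ => dist_nonneg) (fun n => ?_)
    (tendsto_iff_dist_tendsto_zero.1 hg))
  rw [dist_eq_norm (u n) g]
  exact lp.norm_apply_le_norm ENNReal.top_ne_zero (u n - g) p

theorem completeSpace_clipSpace (hab : ∀ i x, a i x < b i x) : CompleteSpace (clipSpace a b) := by
  suffices h : IsClosed (clipSpace a b) from h.completeSpace_coe
  have : clipSpace a b = ⋂ p, {f | clip (a p.2 p.1) (b p.2 p.1) (f.1 p) = f.1 p} := by
    ext f
    simp only [clipSpace, Set.mem_iInter, Set.mem_ofPred_eq, funext_iff]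
    rfl
  rw [this]
  refine isClosed_iInter fun p => isClosed_eq ?_ (continuous_apply_bddMeas p)
  have : Continuous (clip (a p.2 p.1) (b p.2 p.1)) :=
    (LipschitzWith.of_dist_le_mul (K := 1) fun x y => by
      simpa [Real.dist_eq] using abs_clip_sub_clip_le (hab p.2 p.1) x y).continuous
  exact this.comp (continuous_apply_bddMeas p)

/-! ### Estimates for clipped sums and the arc field -/

/-- The clipped sum `[f + v]_a^b`. -/
noncomputable def clipAdd (ha : Measurable fun p : S × J => a p.2 p.1)
    (hb : Measurable fun p : S × J => b p.2 p.1) (hab : ∀ i x, a i x < b i x)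
    (f : clipSpace a b) (v : BddMeas (S × J)) : clipSpace a b :=
  clipArc ha hb hab (fun _ => v) f 1

variable (ha : Measurable fun p : S × J => a p.2 p.1)
    (hb : Measurable fun p : S × J => b p.2 p.1) (hab : ∀ i x, a i x < b i x)

theorem clipAdd_apply (f : clipSpace a b) (v : BddMeas (S × J)) (p : S × J) :
    (clipAdd ha hb hab f v).1.1 p = clip (a p.2 p.1) (b p.2 p.1) (f.1.1 p + v.1 p) := by
  change clip (a p.2 p.1) (b p.2 p.1) (f.1.1 p + 1 * v.1 p) = _
  rw [one_mul]

theorem clipSpace_ext {f g : clipSpace a b} (h : ∀ p, f.1.1 p = g.1.1 p) : f = g :=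
  Subtype.ext (Subtype.ext (lp.ext (funext h)))

theorem clipArc_eq_clipAdd (V : clipSpace a b → BddMeas (S × J)) (f : clipSpace a b) (t : I) :
    clipArc ha hb hab V f t = clipAdd ha hb hab f ((t : ℝ) • V f) :=
  clipSpace_ext fun p => (clipAdd_apply ha hb hab f ((t : ℝ) • V f) p).symm

theorem clipAdd_zero (f : clipSpace a b) : clipAdd ha hb hab f 0 = f :=
  clipSpace_ext fun p => by
    rw [clipAdd_apply]
    change clip _ _ (f.1.1 p + 0) = _
    rw [add_zero, clip_apply_self]

theorem dist_clipAdd_le (f g : clipSpace a b) (v w : BddMeas (S × J)) :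
    dist (clipAdd ha hb hab f v) (clipAdd ha hb hab g w) ≤ dist f g + dist v w := by
  refine dist_le_of_forall_apply (by positivity) fun p => ?_
  rw [clipAdd_apply, clipAdd_apply]
  refine (abs_clip_sub_clip_le (hab _ _) _ _).trans ?_
  have h1 := abs_apply_le_norm (f.1 - g.1) p
  have h2 := abs_apply_le_norm (v - w) p
  rw [← dist_eq_norm] at h1 h2
  change |f.1.1 p - g.1.1 p| ≤ dist f g at h1
  change |v.1 p - w.1 p| ≤ _ at h2
  rw [add_sub_add_comm]
  exact (abs_add_le _ _).trans (add_le_add h1 h2)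

/-- At each coordinate the sign of `v` does not change in time, so the one-directional clipping
identities apply. -/
theorem clipAdd_add_smul (f : clipSpace a b) (v : BddMeas (S × J)) {s t : ℝ} (hs : 0 ≤ s)
    (ht : 0 ≤ t) : clipAdd ha hb hab f ((s + t) • v) =
      clipAdd ha hb hab (clipAdd ha hb hab f (s • v)) (t • v) := by
  refine clipSpace_ext fun p => ?_
  simp only [clipAdd_apply]
  change clip _ _ (f.1.1 p + (s + t) * v.1 p) =
    clip _ _ (clip _ _ (f.1.1 p + s * v.1 p) + t * v.1 p)
  rw [add_mul, ← add_assoc]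
  symm
  rcases le_total 0 (v.1 p) with hv | hv
  · exact clip_add_clip_of_nonneg (hab _ _) (clip_apply_self f p) (by positivity) (by positivity)
  · exact clip_add_clip_of_nonpos (hab _ _) (clip_apply_self f p)
      (mul_nonpos_of_nonneg_of_nonpos hs hv) (mul_nonpos_of_nonneg_of_nonpos ht hv)

/-- The arc field `f ↦ [f + t V(f)]_a^b` for all real times. -/
noncomputable def clipArcReal (V : clipSpace a b → BddMeas (S × J)) (f : clipSpace a b) (t : ℝ) :
    clipSpace a b :=
  clipAdd ha hb hab f (t • V f)

theorem arcBoundsOn_clipArcReal {V : clipSpace a b → BddMeas (S × J)} {U : Set (clipSpace a b)}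
    {K : ℝ≥0} {C : ℝ} (hK : LipschitzOnWith K V U) (hC0 : 0 ≤ C) (hC : ∀ f ∈ U, ‖V f‖ ≤ C) :
    ArcBoundsOn (clipArcReal ha hb hab V) U K C (K * C) where
  K_nonneg := K.2
  C_nonneg := hC0
  Ω_nonneg := mul_nonneg K.2 hC0
  zero f := by rw [clipArcReal, zero_smul, clipAdd_zero]
  lip f hf g hg t ht := by
    refine (dist_clipAdd_le ha hb hab _ _ _ _).trans ?_
    rw [dist_eq_norm, ← smul_sub, norm_smul, ← dist_eq_norm, Real.norm_of_nonneg ht]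
    have := mul_le_mul_of_nonneg_left (hK.dist_le_mul f hf g hg) ht
    linarith
  speed f hf s t := by
    refine (dist_clipAdd_le ha hb hab _ _ _ _).trans ?_
    rw [dist_self, zero_add, dist_eq_norm, ← sub_smul, norm_smul, mul_comm, Real.norm_eq_abs]
    exact mul_le_mul_of_nonneg_right (hC f hf) (abs_nonneg _)
  semigroup f hf s t hs ht hfs := by
    have h1 : dist f (clipArcReal ha hb hab V f s) ≤ s * C := by
      have := dist_clipAdd_le ha hb hab f f 0 (s • V f)
      rw [clipAdd_zero, dist_self, zero_add, dist_zero_left, norm_smul,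
        Real.norm_of_nonneg hs] at this
      exact this.trans (mul_le_mul_of_nonneg_left (hC f hf) hs)
    -- Once the frozen increment is split, both sides start at `X_s f` and differ only in using
    -- `V(f)` or `V(X_s f)`.
    rw [clipArcReal, clipAdd_add_smul ha hb hab f _ hs ht]
    refine (dist_clipAdd_le ha hb hab (clipArcReal ha hb hab V f s) _ _ _).trans ?_
    rw [dist_self, zero_add, dist_eq_norm, ← smul_sub, norm_smul, ← dist_eq_norm, Real.norm_of_nonneg ht]
    have h2 := (hK.dist_le_mul f hf _ hfs).trans (mul_le_mul_of_nonneg_left h1 K.2)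
    calc t * _ ≤ t * (K * (s * C)) := mul_le_mul_of_nonneg_left h2 ht
      _ = s * t * (K * C) := by ring

theorem localArcBounds_clipArcReal {V : clipSpace a b → BddMeas (S × J)} (hV : LocallyLipschitz V) :
    LocalArcBounds (clipArcReal ha hb hab V) := by
  intro p
  obtain ⟨K, t, ht, hK⟩ := hV p
  obtain ⟨r, hr, hrt⟩ := Metric.mem_nhds_iff.1 ht
  refine ⟨r, hr, K, ‖V p‖ + K * r, _, arcBoundsOn_clipArcReal ha hb hab (hK.mono hrt)
    (by positivity) fun f hf => ?_⟩
  have h1 := (hK.mono hrt).dist_le_mul f hf p (Metric.mem_ball_self hr)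
  have h2 : (K : ℝ) * dist f p ≤ K * r :=
    mul_le_mul_of_nonneg_left (Metric.mem_ball.1 hf).le K.2
  have h3 := norm_le_norm_add_norm_sub' (V f) (V p)
  rw [← dist_eq_norm] at h3
  linarith

/-- For globally Lipschitz `V` the time of existence is uniform. -/
theorem exists_hasLine_of_lipschitz [CompleteSpace (clipSpace a b)]
    {V : clipSpace a b → BddMeas (S × J)} {K : ℝ≥0} (hK : LipschitzWith K V) :
    ∃ τ > 0, ∀ f, HasLine (clipArcReal ha hb hab V) f τ := by
  -- On the ball of radius `ρ = ‖V f‖ + 1` the speed is at most `(1 + K) * ρ`, and `(1 + K) * ρ / (2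
  -- + K) < ρ`: the radius grows with `‖V f‖`, so the time need not shrink.
  refine ⟨1 / (2 + K), by positivity, fun f => ?_⟩
  set ρ := ‖V f‖ + 1 with hρ
  have hρ0 : 0 < ρ := by positivity
  have hbd := arcBoundsOn_clipArcReal ha hb hab (hK.lipschitzOnWith (s := Metric.ball f ρ))
    (C := (1 + K) * ρ) (by positivity) fun g hg => by
      have h1 := hK.dist_le_mul g f
      have h2 : (K : ℝ) * dist g f ≤ K * ρ :=
        mul_le_mul_of_nonneg_left (Metric.mem_ball.1 hg).le K.2
      have h3 := norm_le_norm_add_norm_sub' (V g) (V f)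
      rw [← dist_eq_norm] at h3
      linarith
  obtain ⟨γ, h0, h1, -⟩ := hbd.exists_isApproxLine_zero (τ := 1 / (2 + K)) subset_rfl
    (by positivity) (by
      rw [mul_one_div, div_lt_iff₀ (by positivity), mul_comm]
      have := K.2
      gcongr
      norm_num)
  exact ⟨γ, h0, h1⟩

theorem isArcField_clipArc {V : clipSpace a b → BddMeas (S × J)} (hV : Continuous V) :
    IsArcField (clipArc ha hb hab V) where
  continuous := by
    refine continuous_iff_continuousAt.2 fun q => tendsto_iff_dist_tendsto_zero.2 ?_
    have hc : Continuous fun p : clipSpace a b × I =>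
        dist p.1 q.1 + dist ((p.2 : ℝ) • V p.1) ((q.2 : ℝ) • V q.1) := by fun_prop
    refine squeeze_zero (fun _ => dist_nonneg) (fun p => ?_) (by simpa using hc.tendsto q)
    simp only [Function.uncurry, clipArc_eq_clipAdd]
    exact dist_clipAdd_le ha hb hab _ _ _ _
  zero f := by rw [clipArc_eq_clipAdd, Set.Icc.coe_zero, zero_smul, clipAdd_zero]

theorem condE1_clipArc {V : clipSpace a b → BddMeas (S × J)} (hV : LocallyLipschitz V) :
    CondE1 (clipArc ha hb hab V) := fun f₀ => by
  obtain ⟨r, hr, K, C, Ω, hB⟩ := localArcBounds_clipArcReal ha hb hab hV f₀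
  refine ⟨r, hr, 1, one_pos, K, fun f hf g hg t _ => ?_⟩
  rw [clipArc_eq_clipAdd, clipArc_eq_clipAdd]
  exact hB.lip f hf g hg t t.2.1

theorem condE2_clipArc {V : clipSpace a b → BddMeas (S × J)} (hV : LocallyLipschitz V) :
    CondE2 (clipArc ha hb hab V) := fun f₀ => by
  obtain ⟨r, hr, K, C, Ω, hB⟩ := localArcBounds_clipArcReal ha hb hab hV f₀
  have hC := hB.C_nonneg
  -- This bound on `s` makes the arc move less than `r / 2`, so `X_s f` stays in the ball where the
  -- semigroup estimate holds.
  refine ⟨r / 2, by positivity, r / 2 / (C + 1), by positivity, Ω, fun f hf s t u hu _ hs => ?_⟩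
  have hfr : f ∈ Metric.ball f₀ r := Metric.ball_subset_ball (by linarith) hf
  simp only [clipArc_eq_clipAdd, hu]
  refine hB.semigroup f hfr s t s.2.1 t.2.1 (Metric.mem_ball.2 ?_)
  have h1 := hB.dist_arc_le hfr s.2.1
  have h2 := dist_triangle (clipArcReal ha hb hab V f s) f f₀
  have h3 := Metric.mem_ball.1 hf
  rw [lt_div_iff₀ (by positivity)] at hs
  have := s.2.1
  nlinarith

end ClipArc

theorem mainTheorem3 {S J : Type*} [MeasurableSpace S] [MeasurableSpace J]
    (a b : J → S → EReal)
    (ha : Measurable fun p : S × J => a p.2 p.1) (hb : Measurable fun p : S × J => b p.2 p.1)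
    (hab : ∀ i x, a i x < b i x) (hgap : 0 < ⨅ (i) (x), (b i x - a i x))
    (V : clipSpace a b → BddMeas (S × J)) (hV : LocallyLipschitz V) :
    CompleteSpace (clipSpace a b) ∧
    IsArcField (clipArc ha hb hab V) ∧
    CondE1 (clipArc ha hb hab V) ∧
    CondE2 (clipArc ha hb hab V) ∧
    ∃ (T : clipSpace a b → ℝ≥0∞) (F : clipSpace a b → ℝ≥0 → clipSpace a b),
      IsLocalFlowOf (clipArc ha hb hab V) T F ∧
      (∀ (f : clipSpace a b) (s t : ℝ≥0), (s : ℝ≥0∞) < T f →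
        ((t : ℝ≥0∞) < T (F f s) ↔ ((s + t : ℝ≥0) : ℝ≥0∞) < T f)) ∧
      (∀ (T' : clipSpace a b → ℝ≥0∞) (F' : clipSpace a b → ℝ≥0 → clipSpace a b),
        IsLocalFlowOf (clipArc ha hb hab V) T' F' →
          ∀ f, T' f ≤ T f ∧ ∀ t : ℝ≥0, (t : ℝ≥0∞) < T' f → F' f t = F f t) ∧
      ((∃ K : ℝ≥0, LipschitzWith K V) →
        (∀ f, T f = ∞) ∧ IsFlowOf (clipArc ha hb hab V) F ∧
          ∀ F', IsFlowOf (clipArc ha hb hab V) F' → F' = F) := by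
  have hcomp := completeSpace_clipSpace hab
  have hX := localArcBounds_clipArcReal ha hb hab hV
  have hY := clipArc_eq_clipAdd ha hb hab V
  have hflow := isLocalFlowOf_lineFlow hX hY
  refine ⟨hcomp, isArcField_clipArc ha hb hab hV.continuous, condE1_clipArc ha hb hab hV,
    condE2_clipArc ha hb hab hV, life (clipArcReal ha hb hab V),
    fun f t => lineFlow (clipArcReal ha hb hab V) f t, hflow,
    fun f s t hs => lt_life_lineFlow_iff hX hs, fun T' F' h => h.le_life hX hY, ?_⟩
  rintro ⟨K, hK⟩
  obtain ⟨τ, hτ, hl⟩ := exists_hasLine_of_lipschitz ha hb hab hK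
  have htop := life_eq_top hX hτ hl
  refine ⟨htop, isFlowOf_iff_isLocalFlowOf.2 ?_, fun F' hF' => ?_⟩
  · rwa [funext htop] at hflow
  -- A global flow is a local flow with infinite lifetimes, so maximality determines it at all
  -- times.
  · funext f t
    exact ((isFlowOf_iff_isLocalFlowOf.1 hF').le_life hX hY f).2 t (by simp)
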